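/- Let $n_H\le n\le m$ be natural numbers, and let $L_H\in\mathbb{R}^{m\times n_H}$ and $R\in\mathbb{R}^{n\times n_H}$ be arbitrary real matrices. Write $\sigma_l(A)$ for the $l$-th largest singular value of a real matrix $A$ (counted with multiplicity), $\|A\|_*$ for its nuclear norm, i.e. the sum of its singular values, and $\|A\|_2$ for its spectral norm, i.e. the operator norm with respect to the Euclidean norms. Then: 1. $\|L_HR^\top\|_*\ \ge\ \|L_H\|_*-\epsilon$, where $\epsilon=\sum_{k=1}^{r_H}\sigma_k(L_H)\bigl(1-\sigma_{n_H-k+1}(R)\bigr)$ and $r_H=\operatorname{rank}(L_H)$; 2. if $\|R\|_2\le 1$, then also $\|L_H\|_*\ \ge\ \|L_HR^\top\|_*$. -/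

import Mathlib

open scoped Matrix Matrix.Norms.L2Operator

/-- `singVal A l` is the `l`-th largest singular value `σ_l(A)` of a real matrix, `l = 1, 2, …`
(Mathlib's sequence of singular values is indexed from `0`). -/
noncomputable def singVal {m n : ℕ} (A : Matrix (Fin m) (Fin n) ℝ) (l : ℕ) : ℝ :=
  (Matrix.toEuclideanLin A).singularValues (l - 1)

/-- The nuclear norm: the sum of the `min m n` singular values of an `m × n` matrix. -/
noncomputable def nuclearNorm {m n : ℕ} (A : Matrix (Fin m) (Fin n) ℝ) : ℝ :=
  ∑ l ∈ Finset.Icc 1 (min m n), singVal A l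

/-- The defect `ε = ∑_{k=1}^{rank L} σ_k(L) (1 - σ_{n_H-k+1}(R))`. -/
noncomputable def restrictionDefect {m n nH : ℕ} (LH : Matrix (Fin m) (Fin nH) ℝ)
    (R : Matrix (Fin n) (Fin nH) ℝ) : ℝ :=
  ∑ k ∈ Finset.Icc 1 LH.rank, singVal LH k * (1 - singVal R (nH - k + 1))

/-!
The proof rests on the duality between the nuclear norm and the operator norm. For `T : E → F` let
`e` be an orthonormal eigenbasis of `T† T`, so that the vectors `T eᵢ` are orthogonal of length
`σᵢ(T)`. Then `tr (W T) = ∑ᵢ ⟪eᵢ, W T eᵢ⟫ ≤ ∑ᵢ σᵢ(T)` for every contraction `W`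
(`LinearMap.trace_comp_le_sum_singularValues`), and the partial isometry of the polar decomposition,
`W T eᵢ = σᵢ(T) eᵢ`, attains the bound
(`LinearMap.exists_contraction_apply_eq_singularValues_smul`).

*Upper bound.* Choose `W` optimal for `L R†`. Then `tr (W L R†) = tr ((R† W) L)`, and `R† W` is a
contraction when `R` is one.

*Lower bound.* Let `U` and `V` be the contractions for which `U L = |L|` and `V R = |R|`. Since `V† U`
is a contraction, the sum of the singular values of `L R†` is at least
`tr (V† U L R†) = tr (|R| |L|) = ∑ᵢⱼ σᵢ(L) σⱼ(R) ⟪fⱼ, eᵢ⟫²`, with `e` and `f` the two eigenbases.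
The matrix `⟪fⱼ, eᵢ⟫²` is doubly stochastic, so by Birkhoff's theorem the right-hand side is a convex
combination of sums `∑ᵢ σᵢ(L) σ_{π i}(R)`; by the rearrangement inequality none of these is less than
the one pairing the two sequences in opposite orders. That sum is the nuclear norm of `L` minus the
defect; the cut-off of the defect at the rank of `L` is harmless, as `σᵢ(L)` vanishes beyond it.
-/

/-! ### Doubly stochastic matrices and rearrangement -/

/-- The rearrangement inequality for doubly stochastic matrices in place of permutations. -/
theorem Antivary.sum_mul_le_sum_sum_mul_of_mem_doublyStochastic {ι : Type*} [Fintype ι]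
    [DecidableEq ι] {f g : ι → ℝ} (hfg : Antivary f g) {M : Matrix ι ι ℝ}
    (hM : M ∈ doublyStochastic ℝ ι) :
    ∑ i, f i * g i ≤ ∑ i, ∑ j, f i * g j * M i j := by
  obtain ⟨w, hw0, hw1, rfl⟩ := exists_eq_sum_perm_of_mem_doublyStochastic hM
  have key : ∑ i, ∑ j, f i * g j * (∑ σ, w σ • σ.permMatrix ℝ) i j
      = ∑ σ : Equiv.Perm ι, w σ * ∑ i, f i * g (σ i) := by
    simp only [Matrix.sum_apply, Matrix.smul_apply, smul_eq_mul, Finset.mul_sum]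
    rw [Finset.sum_congr rfl fun i _ => Finset.sum_comm, Finset.sum_comm]
    refine Finset.sum_congr rfl fun σ _ => Finset.sum_congr rfl fun i _ => ?_
    rw [Finset.sum_eq_single (σ i)]
    · simp [Equiv.Perm.permMatrix, PEquiv.toMatrix_apply]
      ring
    · intro j _ hj
      simp [Equiv.Perm.permMatrix, PEquiv.toMatrix_apply, Ne.symm hj]
    · simp
  rw [key, ← one_mul (∑ i, f i * g i), ← hw1, Finset.sum_mul]
  exact Finset.sum_le_sum fun σ _ =>
    mul_le_mul_of_nonneg_left hfg.sum_mul_le_sum_mul_comp_perm (hw0 σ)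

theorem OrthonormalBasis.sq_inner_mem_doublyStochastic {ι E : Type*} [Fintype ι] [DecidableEq ι]
    [NormedAddCommGroup E] [InnerProductSpace ℝ E] (e f : OrthonormalBasis ι ℝ E) :
    (Matrix.of fun i j => inner ℝ (f j) (e i) ^ 2) ∈ doublyStochastic ℝ ι := by
  refine mem_doublyStochastic_iff_sum.2 ⟨fun i j => sq_nonneg _, fun i => ?_, fun j => ?_⟩
  · simpa using f.sum_sq_norm_inner_right (e i)
  · simpa using e.sum_sq_norm_inner_left (f j)

/-! ### Duality for the sum of the singular values -/

namespace LinearMap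

open Module

variable {E F G : Type*} [NormedAddCommGroup E] [InnerProductSpace ℝ E] [FiniteDimensional ℝ E]
  [NormedAddCommGroup F] [InnerProductSpace ℝ F] [FiniteDimensional ℝ F]
  [NormedAddCommGroup G] [InnerProductSpace ℝ G] [FiniteDimensional ℝ G]

theorem exists_orthonormalBasis_inner_apply_apply (T : E →ₗ[ℝ] F) {n : ℕ} (hn : finrank ℝ E = n) :
    ∃ e : OrthonormalBasis (Fin n) ℝ E, ∀ i j,
      inner ℝ (T (e i)) (T (e j)) = if i = j then T.singularValues i ^ 2 else 0 := by
  have hT := T.isSymmetric_adjoint_comp_self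
  refine ⟨hT.eigenvectorBasis hn, fun i j => ?_⟩
  rw [← adjoint_inner_left, ← comp_apply, hT.apply_eigenvectorBasis hn i,
    ← T.sq_singularValues_fin hn i]
  simp only [RCLike.ofReal_real_eq_id, real_inner_smul_left,
    orthonormal_iff_ite.1 (hT.eigenvectorBasis hn).orthonormal i j]
  simp

/-- The partial isometry of the polar decomposition: a contraction `W` such that `W ∘ T` is the
positive square root of `T† T`, which is diagonal in an orthonormal basis. -/
theorem exists_contraction_apply_eq_singularValues_smul (T : E →ₗ[ℝ] F) {n : ℕ}
    (hn : finrank ℝ E = n) :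
    ∃ (e : OrthonormalBasis (Fin n) ℝ E) (W : F →ₗ[ℝ] E), (∀ y, ‖W y‖ ≤ ‖y‖) ∧
      ∀ i, W (T (e i)) = T.singularValues i • e i := by
  obtain ⟨e, he⟩ := T.exists_orthonormalBasis_inner_apply_apply hn
  -- Where the singular value is zero, `0⁻¹ = 0` makes `u i` zero; the other `u i` are orthonormal.
  set u : Fin n → F := fun i => (T.singularValues i)⁻¹ • T (e i) with hu
  have huT : ∀ i j, inner ℝ (u i) (T (e j)) = if i = j then T.singularValues i else 0 := by
    intro i j
    simp only [hu, real_inner_smul_left, he]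
    split_ifs
    · by_cases h : T.singularValues i = 0
      · simp [h]
      · field_simp
    · simp
  have hon : Orthonormal ℝ fun i : {i : Fin n // T.singularValues i ≠ 0} => u i := by
    rw [orthonormal_iff_ite]
    rintro ⟨i, hi⟩ ⟨j, hj⟩
    have : inner ℝ (u i) (u j) = (T.singularValues j)⁻¹ * inner ℝ (u i) (T (e j)) := by
      simp only [hu, real_inner_smul_right]
    rw [this, huT]
    by_cases h : i = j
    · subst h
      simp [hi]
    · simp [h]
  have hbessel : ∀ y, ∑ i, inner ℝ (u i) y ^ 2 ≤ ‖y‖ ^ 2 := by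
    intro y
    have hsub := hon.sum_inner_products_le (s := Finset.univ) y
    have : ∑ i, inner ℝ (u i) y ^ 2
        = ∑ i : {i : Fin n // T.singularValues i ≠ 0}, inner ℝ (u i) y ^ 2 := by
      rw [← Finset.sum_subtype (Finset.univ.filter fun i : Fin n => T.singularValues i ≠ 0)
        (by simp) fun i => inner ℝ (u i) y ^ 2]
      refine (Finset.sum_filter_of_ne fun i _ hi => ?_).symm
      contrapose! hi
      simp [hu, hi]
    rw [this]
    simpa using hsub
  refine ⟨e, ∑ i, ((innerₛₗ ℝ (u i)).smulRight (e i)), fun y => ?_, fun j => ?_⟩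
  · refine le_of_sq_le_sq ?_ (norm_nonneg y)
    refine le_trans (le_of_eq ?_) (hbessel y)
    rw [← e.sum_sq_norm_inner_right]
    refine Finset.sum_congr rfl fun j _ => ?_
    simp [inner_sum, real_inner_smul_right, orthonormal_iff_ite.1 e.orthonormal]
  · simp [huT]

theorem trace_comp_le_sum_singularValues (T : E →ₗ[ℝ] F) {W : F →ₗ[ℝ] E}
    (hW : ∀ y, ‖W y‖ ≤ ‖y‖) {n : ℕ} (hn : finrank ℝ E = n) :
    trace ℝ E (W ∘ₗ T) ≤ ∑ i ∈ Finset.range n, T.singularValues i := by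
  obtain ⟨e, he⟩ := T.exists_orthonormalBasis_inner_apply_apply hn
  rw [trace_eq_sum_inner _ e, ← Fin.sum_univ_eq_sum_range (fun i => T.singularValues i)]
  refine Finset.sum_le_sum fun i _ => ?_
  have hTe : ‖T (e i)‖ = T.singularValues i := by
    rw [← sq_eq_sq₀ (norm_nonneg _) (T.singularValues_nonneg _), ← real_inner_self_eq_norm_sq, he,
      if_pos rfl]
  calc inner ℝ (e i) ((W ∘ₗ T) (e i)) ≤ ‖e i‖ * ‖W (T (e i))‖ := real_inner_le_norm _ _
    _ ≤ T.singularValues i := by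
      rw [e.norm_eq_one, one_mul, ← hTe]
      exact hW _

theorem exists_contraction_trace_comp_eq_sum_singularValues (T : E →ₗ[ℝ] F) {n : ℕ}
    (hn : finrank ℝ E = n) :
    ∃ W : F →ₗ[ℝ] E, (∀ y, ‖W y‖ ≤ ‖y‖) ∧
      trace ℝ E (W ∘ₗ T) = ∑ i ∈ Finset.range n, T.singularValues i := by
  obtain ⟨e, W, hW, hWT⟩ := T.exists_contraction_apply_eq_singularValues_smul hn
  refine ⟨W, hW, ?_⟩
  rw [trace_eq_sum_inner _ e, ← Fin.sum_univ_eq_sum_range (fun i => T.singularValues i)]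
  simp [hWT, real_inner_smul_right]

theorem norm_adjoint_apply_le {W : E →ₗ[ℝ] F} (hW : ∀ x, ‖W x‖ ≤ ‖x‖) (y : F) :
    ‖adjoint W y‖ ≤ ‖y‖ := by
  have h : ‖adjoint W y‖ * ‖adjoint W y‖ ≤ ‖y‖ * ‖adjoint W y‖ := by
    rw [← real_inner_self_eq_norm_mul_norm, adjoint_inner_left]
    exact (real_inner_le_norm _ _).trans
      (mul_le_mul_of_nonneg_left (hW _) (norm_nonneg _))
  rcases (norm_nonneg (adjoint W y)).eq_or_lt with h0 | h0
  · exact h0 ▸ norm_nonneg y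
  · exact le_of_mul_le_mul_right h h0

/-! ### Singular values of `L R†` -/

theorem sum_singularValues_comp_adjoint_le (L : E →ₗ[ℝ] F) {R : E →ₗ[ℝ] G}
    (hR : ∀ x, ‖R x‖ ≤ ‖x‖) {n p : ℕ} (hn : finrank ℝ E = n) (hp : finrank ℝ G = p) :
    ∑ i ∈ Finset.range p, (L ∘ₗ adjoint R).singularValues i
      ≤ ∑ i ∈ Finset.range n, L.singularValues i := by
  obtain ⟨W, hW, htr⟩ := (L ∘ₗ adjoint R).exists_contraction_trace_comp_eq_sum_singularValues hp
  rw [← htr, ← comp_assoc, trace_comp_comm', ← comp_assoc]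
  exact L.trace_comp_le_sum_singularValues
    (fun y => (norm_adjoint_apply_le hR _).trans (hW y)) hn

/-- A lower bound for the sum of the singular values of `L R†`, by the singular values of the factors
paired in opposite orders. -/
theorem sum_singularValues_mul_rev_le (L : E →ₗ[ℝ] F) (R : E →ₗ[ℝ] G) {n p : ℕ}
    (hn : finrank ℝ E = n) (hp : finrank ℝ G = p) :
    ∑ i ∈ Finset.range n, L.singularValues i * R.singularValues (n - 1 - i)
      ≤ ∑ i ∈ Finset.range p, (L ∘ₗ adjoint R).singularValues i := by
  obtain ⟨e, U, hU, hUL⟩ := L.exists_contraction_apply_eq_singularValues_smul hn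
  obtain ⟨f, V, hV, hVR⟩ := R.exists_contraction_apply_eq_singularValues_smul hn
  have hVU : ∀ y, ‖(adjoint V ∘ₗ U) y‖ ≤ ‖y‖ :=
    fun y => (norm_adjoint_apply_le hV _).trans (hU y)
  have hVRe : ∀ i, inner ℝ (V (R (e i))) (e i)
      = ∑ j : Fin n, R.singularValues j * inner ℝ (f j) (e i) ^ 2 := by
    intro i
    have hsum : V (R (e i)) = ∑ j, inner ℝ (f j) (e i) • R.singularValues j • f j := by
      conv_lhs => rw [← f.sum_repr' (e i)]
      simp [hVR]
    rw [hsum, sum_inner]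
    refine Finset.sum_congr rfl fun j _ => ?_
    rw [real_inner_smul_left, real_inner_smul_left]
    ring
  -- The trace of `|R| |L|`, evaluated in the eigenbasis of `|L|`.
  have htr : trace ℝ G ((adjoint V ∘ₗ U) ∘ₗ (L ∘ₗ adjoint R))
      = ∑ i : Fin n, ∑ j : Fin n,
        L.singularValues i * R.singularValues j * inner ℝ (f j) (e i) ^ 2 := by
    rw [← comp_assoc, trace_comp_comm', trace_eq_sum_inner _ e]
    refine Finset.sum_congr rfl fun i _ => ?_
    rw [comp_apply, comp_apply, comp_apply, hUL, adjoint_inner_right, adjoint_inner_right,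
      real_inner_smul_right, hVRe, Finset.mul_sum]
    exact Finset.sum_congr rfl fun j _ => (mul_assoc _ _ _).symm
  refine le_trans ?_ ((L ∘ₗ adjoint R).trace_comp_le_sum_singularValues hVU hp)
  have hanti : Antivary (fun i : Fin n => L.singularValues i)
      fun i : Fin n => R.singularValues (Fin.rev i) := by
    have hL : Antitone fun i : Fin n => L.singularValues i :=
      fun i j hij => L.singularValues_antitone hij
    have hR : Monotone fun i : Fin n => R.singularValues (Fin.rev i) :=
      fun i j hij => R.singularValues_antitone (Fin.rev_le_rev.2 hij)
    exact hL.antivary hR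
  -- `σ(R)` is listed in increasing order here, so the eigenbasis `f` has to be listed backwards too.
  have h := hanti.sum_mul_le_sum_sum_mul_of_mem_doublyStochastic
    (e.sq_inner_mem_doublyStochastic (f.reindex Fin.revPerm))
  rw [← Fin.sum_univ_eq_sum_range
    (fun i => L.singularValues i * R.singularValues (n - 1 - i)), htr]
  refine (le_of_eq ?_).trans (h.trans (le_of_eq ?_))
  · refine Fintype.sum_congr _ _ fun i => ?_
    rw [Fin.val_rev, Nat.sub_sub, add_comm]
  · refine Fintype.sum_congr _ _ fun i => ?_
    rw [← Equiv.sum_comp Fin.revPerm fun j : Fin n =>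
      L.singularValues i * R.singularValues j * inner ℝ (f j) (e i) ^ 2]
    simp

end LinearMap

/-! ### Matrices -/

theorem Matrix.toEuclideanLin_mul_transpose {m n k : ℕ} (A : Matrix (Fin m) (Fin k) ℝ)
    (B : Matrix (Fin n) (Fin k) ℝ) :
    Matrix.toEuclideanLin (A * Bᵀ)
      = Matrix.toEuclideanLin A ∘ₗ LinearMap.adjoint (Matrix.toEuclideanLin B) := by
  rw [← Matrix.toEuclideanLin_conjTranspose_eq_adjoint, Matrix.conjTranspose_eq_transpose_of_trivial]
  ext x i
  simp [Matrix.toLpLin_apply, Matrix.mulVec_mulVec]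

theorem Finset.sum_Icc_one_eq_sum_range {M : Type*} [AddCommMonoid M] (f : ℕ → M) (n : ℕ) :
    ∑ k ∈ Finset.Icc 1 n, f k = ∑ i ∈ Finset.range n, f (i + 1) := by
  rw [Finset.range_eq_Ico, Finset.sum_Ico_add' f 0 n 1, zero_add, Finset.Ico_add_one_right_eq_Icc]

theorem nuclearNorm_eq_sum_range {m n : ℕ} (h : n ≤ m) (A : Matrix (Fin m) (Fin n) ℝ) :
    nuclearNorm A = ∑ i ∈ Finset.range n, (Matrix.toEuclideanLin A).singularValues i := by
  simp only [nuclearNorm, singVal, min_eq_right h, Finset.sum_Icc_one_eq_sum_range,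
    Nat.add_sub_cancel]

/-- The terms of the defect beyond the rank vanish, so the sum may run over all indices. -/
theorem restrictionDefect_eq_sum_range {m n nH : ℕ} (LH : Matrix (Fin m) (Fin nH) ℝ)
    (R : Matrix (Fin n) (Fin nH) ℝ) :
    restrictionDefect LH R = ∑ i ∈ Finset.range nH,
      (Matrix.toEuclideanLin LH).singularValues i *
        (1 - (Matrix.toEuclideanLin R).singularValues (nH - 1 - i)) := by
  have hrank : LH.rank = Module.finrank ℝ (LinearMap.range (Matrix.toEuclideanLin LH)) := by
    rw [Matrix.toEuclideanLin_eq_toLin_orthonormal, ← Matrix.rank_eq_finrank_range_toLin]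
  have hle : LH.rank ≤ nH := by simpa using LH.rank_le_width
  rw [← Finset.sum_subset (Finset.range_mono hle)]
  · simp only [restrictionDefect, singVal, Finset.sum_Icc_one_eq_sum_range, Nat.add_sub_cancel,
      Nat.sub_sub, Nat.add_comm]
  · intro i _ hi
    rw [(LinearMap.singularValues_eq_zero_iff_le_finrank_range _).2, zero_mul]
    rw [← hrank]
    simpa using hi

theorem mainTheorem4 (m n nH : ℕ) (hnH : nH ≤ n) (hn : n ≤ m)
    (LH : Matrix (Fin m) (Fin nH) ℝ) (R : Matrix (Fin n) (Fin nH) ℝ) :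
    nuclearNorm (LH * Rᵀ) ≥ nuclearNorm LH - restrictionDefect LH R ∧
      (‖R‖ ≤ 1 → nuclearNorm LH ≥ nuclearNorm (LH * Rᵀ)) := by
  rw [nuclearNorm_eq_sum_range hn, nuclearNorm_eq_sum_range (hnH.trans hn),
    restrictionDefect_eq_sum_range, Matrix.toEuclideanLin_mul_transpose]
  refine ⟨?_, fun hR => ?_⟩
  · rw [← Finset.sum_sub_distrib]
    refine le_trans (le_of_eq ?_) (LinearMap.sum_singularValues_mul_rev_le
      (Matrix.toEuclideanLin LH) (Matrix.toEuclideanLin R) finrank_euclideanSpace_fin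
      finrank_euclideanSpace_fin)
    exact Finset.sum_congr rfl fun i _ => by ring
  · refine LinearMap.sum_singularValues_comp_adjoint_le _ (fun x => ?_)
      finrank_euclideanSpace_fin finrank_euclideanSpace_fin
    calc ‖Matrix.toEuclideanLin R x‖ ≤ ‖R‖ * ‖x‖ := R.l2_opNorm_mulVec x
      _ ≤ ‖x‖ := mul_le_of_le_one_left (norm_nonneg x) hR
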